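/- Let $G=\operatorname{PSL}_2(\mathbb R)$ act on $\mathbb H$ and on $\mathbb R\cup\{\infty\}$ by Möbius transformations, and on $T^1\mathbb H=\mathbb H\times\mathbb R/2\pi\mathbb Z$ by $\gamma(z,\theta)=\left(\frac{az+b}{cz+d},\,\theta-2\arg(cz+d)\right)$ for $\gamma=\begin{pmatrix}a&b\\c&d\end{pmatrix}$. Let $\Gamma\subset G$ be a cofinite Fuchsian group (discrete, of finite hyperbolic covolume), and let $\kappa_1=\infty,\kappa_2,\dots,\kappa_q$ be pairwise $\Gamma$-inequivalent cusps of $\Gamma$ with stabilizers $\Gamma_1,\dots,\Gamma_q$ in $\Gamma$, where $\Gamma_1=\Gamma_\infty:=\left\{\begin{pmatrix}1&b\\0&1\end{pmatrix}: b\in\mathbb Z\right\}$. For each $j$ fix a scaling matrix $\sigma_j\in G$, that is, $\sigma_j\infty=\kappa_j$ and $\sigma_j^{-1}\Gamma_j\sigma_j=\Gamma_\infty$, with $\sigma_1=1$. Let $h:\mathbb R/\mathbb Z\times\mathbb R/2\pi\mathbb Z\to\mathbb C$ be $C^\infty$. Let $\rho(x)=\ell^{-1}e^{-1/(1-x^2)}$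 for $|x|<1$ and $\rho(x)=0$ for $|x|\ge1$, where $\ell=\int_{-1}^1e^{-1/(1-x^2)}\,dx$, and let $\rho_\varepsilon(x)=\varepsilon^{-1}\rho(x/\varepsilon)$. For $T>0$ and $y>0$ put $\mathbb 1_{[T,\infty),0}(y)=\mathbb 1_{[T,\infty)}(y)$ and, for real $\eta\neq0$, $$\mathbb 1_{[T,\infty),\eta}(y)=\left(\mathbb 1_{[-T+\eta/2,\infty)}*\rho_{|\eta|/2}\right)(y-2T).$$ With $z=x+iy$ put $f_{T,\eta}(z,\theta)=\mathbb 1_{[T,\infty),\eta}(y)\,h(x,\theta)$ and $g_{T,\eta}(z,\theta)=\mathbb 1_{[T,\infty),\eta}(y)\int_0^1h(t,\theta)\,dt$, and $$\phi^{(\kappa_j)}_{T,\eta}(z,\theta)=\sum_{\gamma\in\Gamma_j\backslash\Gamma}f_{T,\eta}\left(\sigma_j^{-1}\gamma(z,\theta)\right),\qquad \varphi^{(\kappa_j)}_{T,\eta}(z,\theta)=\sum_{\gamma\in\Gamma_j\backslash\Gamma}g_{T,\eta}\left(\sigma_j^{-1}\gamma(z,\theta)\right).$$ **Theorem.** Let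 $j\in\{1,\dots,q\}$ and $L\in\mathbb R$. There is a constant $C$, depending only on $\Gamma$, the cusps (with their scaling matrices), $j$, $h$ and $L$, such that the following holds for all real $1<B_0<B_1\le T$, all $0<\delta\le\frac12$, all real $\eta,\widetilde\eta$ (zero allowed) with $|\eta|,|\widetilde\eta|\le\min\left(\frac{B_1-B_0}2,\frac14\right)$, all $y>0$ with $T-\min\left(\frac{B_1-B_0}2,\frac14\right)>y$, and all real $\alpha,\beta$ with $T^{-3/4+\delta}<\beta-\alpha\le L$. The functions $x\mapsto\phi^{(\kappa_j)}_{T,\eta}(x+iy,0)$ and $x\mapsto\varphi^{(\kappa_j)}_{T,\widetilde\eta}(x+iy,0)$ are integrable on $[\alpha,\beta]$, and $$\left|\int_\alpha^\beta\phi^{(\kappa_j)}_{T,\eta}(x+iy,0)\,dx-\int_\alpha^\beta\varphi^{(\kappa_j)}_{T,\widetilde\eta}(x+iy,0)\,dx\right|\le C\,T^{-\delta}.$$ -/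

import Mathlib

open MeasureTheory
open scoped MatrixGroups UpperHalfPlane

noncomputable section

/-- Centre of `SL(2, ℝ)`: only `1` and `-1`. -/
theorem sl_center_eq {g : SL(2, ℝ)} (hg : g ∈ Subgroup.center SL(2, ℝ)) : g = 1 ∨ g = -1 := by
  obtain ⟨r, hr, hg⟩ := Matrix.SpecialLinearGroup.mem_center_iff.mp hg
  have hr2 : r = 1 ∨ r = -1 := by
    simpa using hr
  rcases hr2 with rfl | rfl
  · left
    apply Subtype.ext
    rw [← hg]
    simp
  · right
    apply Subtype.ext
    rw [← hg]
    ext i j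
    fin_cases i <;> fin_cases j <;> simp

/-- An action of `SL(2, ℝ)` for which `-1` acts trivially descends to `PSL(2, ℝ)`. -/
abbrev pslActionOf (X : Type) [MulAction SL(2, ℝ) X]
    (h : ∀ x : X, (-1 : SL(2, ℝ)) • x = x) : MulAction PSL(2, ℝ) X :=
  MulAction.compHom X (QuotientGroup.lift (Subgroup.center SL(2, ℝ))
    (MulAction.toPermHom SL(2, ℝ) X) (by
      intro g hg
      rcases sl_center_eq hg with rfl | rfl
      · exact map_one _
      · exact Equiv.ext fun x => h x))

/-- `PSL(2, ℝ)` acts on the upper half-plane by Möbius transformations. -/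
instance pslActionUpperHalfPlane : MulAction PSL(2, ℝ) ℍ :=
  pslActionOf ℍ (fun z => by
    apply UpperHalfPlane.ext
    rw [UpperHalfPlane.coe_specialLinearGroup_apply]
    simp)

theorem psl_smul_upperHalfPlane (g : SL(2, ℝ)) (z : ℍ) :
    (QuotientGroup.mk g : PSL(2, ℝ)) • z = g • z := rfl

/-- `SL(2, ℝ)` acts on `ℝ ∪ {∞}` by Möbius transformations. -/
instance slActionOnePoint : MulAction SL(2, ℝ) (OnePoint ℝ) :=
  MulAction.compHom (OnePoint ℝ) (Matrix.SpecialLinearGroup.mapGL (R := ℝ) ℝ)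

/-- `PSL(2, ℝ)` acts on `ℝ ∪ {∞}` by Möbius transformations. -/
instance pslActionOnePoint : MulAction PSL(2, ℝ) (OnePoint ℝ) :=
  pslActionOf (OnePoint ℝ) (fun x => by
    change Matrix.SpecialLinearGroup.mapGL (R := ℝ) ℝ (-1 : SL(2, ℝ)) • x = x
    induction x using OnePoint.rec with
    | infty => simp [OnePoint.smul_infty_eq_ite]
    | coe t => simp [OnePoint.smul_some_eq_ite])

theorem psl_smul_onePoint (g : SL(2, ℝ)) (x : OnePoint ℝ) :
    (QuotientGroup.mk g : PSL(2, ℝ)) • x = Matrix.SpecialLinearGroup.mapGL (R := ℝ) ℝ g • x := rfl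

/-- The unit tangent bundle `T¹ℍ`: a base point and a direction in `ℝ / 2πℤ`. -/
@[ext] structure UnitTangent where
  pt : ℍ
  dir : Real.Angle

/-- The automorphy factor `cz + d` of `g = (a b; c d)`. -/
def slDenom (g : SL(2, ℝ)) (z : ℍ) : ℂ := ((g 1 0 : ℝ) : ℂ) * z + ((g 1 1 : ℝ) : ℂ)

theorem slDenom_eq (g : SL(2, ℝ)) (z : ℍ) :
    slDenom g z = UpperHalfPlane.denom (Matrix.SpecialLinearGroup.mapGL (R := ℝ) ℝ g) z := rfl

theorem slDenom_ne_zero (g : SL(2, ℝ)) (z : ℍ) : slDenom g z ≠ 0 := by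
  rw [slDenom_eq]; exact UpperHalfPlane.denom_ne_zero _ z

theorem slDenom_mul (g h : SL(2, ℝ)) (z : ℍ) :
    slDenom (g * h) z = slDenom g (h • z) * slDenom h z := by
  have hz := slDenom_ne_zero h z
  have key : ((h • z : ℍ) : ℂ) * slDenom h z =
      ((h 0 0 : ℝ) : ℂ) * z + ((h 0 1 : ℝ) : ℂ) := by
    rw [UpperHalfPlane.coe_specialLinearGroup_apply]
    exact div_mul_cancel₀ _ hz
  have h0 : (g * h) 1 0 = g 1 0 * h 0 0 + g 1 1 * h 1 0 := by
    rw [Matrix.SpecialLinearGroup.coe_mul, Matrix.mul_apply, Fin.sum_univ_two]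
  have h1 : (g * h) 1 1 = g 1 0 * h 0 1 + g 1 1 * h 1 1 := by
    rw [Matrix.SpecialLinearGroup.coe_mul, Matrix.mul_apply, Fin.sum_univ_two]
  have e : slDenom g (h • z) * slDenom h z =
      ((g 1 0 : ℝ) : ℂ) * (((h • z : ℍ) : ℂ) * slDenom h z)
        + ((g 1 1 : ℝ) : ℂ) * slDenom h z := by
    rw [slDenom.eq_def g (h • z)]
    ring
  rw [e, key, slDenom, h0, h1, slDenom]
  push_cast
  ring

/-- `g (z, θ) = (g z, θ - 2 arg (cz + d))`. -/
instance slActionUnitTangent : MulAction SL(2, ℝ) UnitTangent where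
  smul g p := ⟨g • p.pt, p.dir - ((2 * Complex.arg (slDenom g p.pt) : ℝ) : Real.Angle)⟩
  one_smul p := by
    change UnitTangent.mk _ _ = _
    simp [slDenom]
  mul_smul g h p := by
    change UnitTangent.mk _ _ = UnitTangent.mk _ _
    have key := Complex.arg_mul_coe_angle (slDenom_ne_zero g (h • p.pt)) (slDenom_ne_zero h p.pt)
    ext1
    · exact mul_smul g h p.pt
    · change p.dir - _ = p.dir - ((2 * Complex.arg (slDenom h p.pt) : ℝ) : Real.Angle)
        - ((2 * Complex.arg (slDenom g (h • p.pt)) : ℝ) : Real.Angle)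
      rw [slDenom_mul, two_mul, two_mul, two_mul]
      simp only [Real.Angle.coe_add, key]
      abel

/-- `PSL(2, ℝ)` acts on the unit tangent bundle. -/
instance pslActionUnitTangent : MulAction PSL(2, ℝ) UnitTangent :=
  pslActionOf UnitTangent (fun p => by
    change UnitTangent.mk _ _ = _
    ext1
    · change (QuotientGroup.mk (-1 : SL(2, ℝ)) : PSL(2, ℝ)) • p.pt = p.pt
      have : (QuotientGroup.mk (-1 : SL(2, ℝ)) : PSL(2, ℝ)) = 1 :=
        (QuotientGroup.eq_one_iff _).mpr (Matrix.SpecialLinearGroup.mem_center_iff.mpr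
          ⟨-1, by simp, by ext i j; fin_cases i <;> fin_cases j <;> simp⟩)
      rw [this, one_smul]
    · simp [slDenom, Complex.arg_neg_one])

theorem psl_smul_unitTangent (g : SL(2, ℝ)) (p : UnitTangent) :
    (QuotientGroup.mk g : PSL(2, ℝ)) • p =
      ⟨g • p.pt, p.dir - ((2 * Complex.arg (slDenom g p.pt) : ℝ) : Real.Angle)⟩ := rfl

/-- A cofinite Fuchsian group: a discrete subgroup of `PSL(2, ℝ)` with a fundamental domain of
finite hyperbolic area (`volume` on `ℍ` is the measure `y⁻² dx dy`). -/
structure IsCofiniteFuchsian (Γ : Subgroup PSL(2, ℝ)) : Prop where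
  discrete : DiscreteTopology Γ
  finite_area : ∃ F : Set ℍ, IsFundamentalDomain Γ F volume ∧ volume F < ⊤

/-- A cusp of `Γ`: a point of `ℝ ∪ {∞}` fixed by a parabolic element of (the preimage of) `Γ`. -/
def IsCuspOf (Γ : Subgroup PSL(2, ℝ)) (κ : OnePoint ℝ) : Prop :=
  IsCusp κ ((Γ.comap (QuotientGroup.mk' (Subgroup.center SL(2, ℝ)))).map
    (Matrix.SpecialLinearGroup.mapGL (R := ℝ) ℝ))

/-- The stabilizer in `Γ` of the point `κ`, as a subgroup of `PSL(2, ℝ)`. -/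
def cuspStabilizer (Γ : Subgroup PSL(2, ℝ)) (κ : OnePoint ℝ) : Subgroup PSL(2, ℝ) :=
  Γ ⊓ MulAction.stabilizer PSL(2, ℝ) κ

/-- The translation matrix `(1 b; 0 1)`. -/
def translationMatrix (b : ℝ) : SL(2, ℝ) := ⟨!![1, b; 0, 1], by simp⟩

/-- `Γ_∞`, the group of the classes of `(1 b; 0 1)` with `b ∈ ℤ`. -/
def gammaInfty : Subgroup PSL(2, ℝ) where
  carrier := {g | ∃ b : ℤ, g = QuotientGroup.mk (translationMatrix b)}
  one_mem' := ⟨0, by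
    rw [← QuotientGroup.mk_one]
    congr 1
    ext i j
    fin_cases i <;> fin_cases j <;> simp [translationMatrix]⟩
  mul_mem' := by
    rintro _ _ ⟨a, rfl⟩ ⟨b, rfl⟩
    refine ⟨a + b, ?_⟩
    rw [← QuotientGroup.mk_mul]
    congr 1
    ext i j
    rw [Matrix.SpecialLinearGroup.coe_mul]
    fin_cases i <;> fin_cases j <;>
      simp [translationMatrix, Matrix.mul_apply, Fin.sum_univ_two, add_comm]
  inv_mem' := by
    rintro _ ⟨a, rfl⟩
    refine ⟨-a, ?_⟩
    rw [← QuotientGroup.mk_inv]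
    congr 1
    ext i j
    rw [Matrix.SpecialLinearGroup.coe_inv]
    fin_cases i <;> fin_cases j <;> simp [translationMatrix, Matrix.adjugate_fin_two]

/-- `σ` is a scaling matrix for the cusp `κ`: `σ ∞ = κ` and `σ⁻¹ Γ_κ σ = Γ_∞`. -/
structure IsScalingMatrix (Γ : Subgroup PSL(2, ℝ)) (κ : OnePoint ℝ) (σ : PSL(2, ℝ)) : Prop where
  smul_infty : σ • (OnePoint.infty : OnePoint ℝ) = κ
  conj_eq : (cuspStabilizer Γ κ).map (MulAut.conj σ⁻¹).toMonoidHom = gammaInfty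

/-- The normalizing constant `∫_{-1}^1 exp(-1/(1-x²)) dx`. -/
def mollifierNorm : ℝ := ∫ x in (-1 : ℝ)..1, Real.exp (-1 / (1 - x ^ 2))

open scoped Classical in
/-- The standard mollifier `ρ`. -/
def mollifier (x : ℝ) : ℝ :=
  if |x| < 1 then mollifierNorm⁻¹ * Real.exp (-1 / (1 - x ^ 2)) else 0

/-- `ρ_ε(x) = ε⁻¹ ρ(x/ε)`. -/
def mollifierScaled (ε x : ℝ) : ℝ := 1 / ε * mollifier (x / ε)

open scoped Classical in
/-- The (smoothed) indicator `𝟙_{[T,∞),η}`: the plain indicator of `[T, ∞)` for `η = 0`, and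
`(𝟙_{[-T+η/2,∞)} * ρ_{|η|/2})(y - 2T)` for `η ≠ 0`. -/
def cuspCutoff (T η y : ℝ) : ℝ :=
  if η = 0 then (Set.Ici T).indicator 1 y
  else ∫ s : ℝ, (Set.Ici (-T + η / 2)).indicator 1 (y - 2 * T - s) * mollifierScaled (|η| / 2) s

/-- Smoothness of a function on the torus `ℝ/ℤ × ℝ/2πℤ`, read on the universal cover `ℝ²`. -/
def SmoothOnTorus (h : AddCircle (1 : ℝ) → Real.Angle → ℂ) : Prop :=
  ContDiff ℝ (⊤ : ℕ∞) (fun p : ℝ × ℝ => h (p.1 : AddCircle (1 : ℝ)) (p.2 : Real.Angle))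

/-- `f_{T,η}(z, θ) = 𝟙_{[T,∞),η}(y) h(x, θ)`. -/
def cuspFun (h : AddCircle (1 : ℝ) → Real.Angle → ℂ) (T η : ℝ) (p : UnitTangent) : ℂ :=
  (cuspCutoff T η p.pt.im : ℂ) * h (p.pt.re : AddCircle (1 : ℝ)) p.dir

/-- `g_{T,η}(z, θ) = 𝟙_{[T,∞),η}(y) ∫₀¹ h(t, θ) dt`. -/
def cuspFunAvg (h : AddCircle (1 : ℝ) → Real.Angle → ℂ) (T η : ℝ) (p : UnitTangent) : ℂ :=
  (cuspCutoff T η p.pt.im : ℂ) * ∫ t in (0 : ℝ)..1, h (t : AddCircle (1 : ℝ)) p.dir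

/-- The automorphic sum `∑_{γ ∈ Γ_κ \ Γ} f(σ⁻¹ γ p)`. The index type is the set of cosets `Γ_κ γ`,
and the sum is evaluated on a representative of each coset; for `σ` a scaling matrix and `f`
invariant under `Γ_∞` the term does not depend on the representative. -/
def cuspSum (Γ : Subgroup PSL(2, ℝ)) (κ : OnePoint ℝ) (σ : PSL(2, ℝ)) (f : UnitTangent → ℂ)
    (p : UnitTangent) : ℂ :=
  ∑' c : Quotient (QuotientGroup.rightRel ((cuspStabilizer Γ κ).subgroupOf Γ)),
    f (σ⁻¹ • (((Quotient.out c : Γ) : PSL(2, ℝ)) • p))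

/-- The test function `φ^{(κ)}_{T,η}`. -/
def testFun (Γ : Subgroup PSL(2, ℝ)) (κ : OnePoint ℝ) (σ : PSL(2, ℝ))
    (h : AddCircle (1 : ℝ) → Real.Angle → ℂ) (T η : ℝ) : UnitTangent → ℂ :=
  cuspSum Γ κ σ (cuspFun h T η)

/-- The test function built from the `x`-average of `h`. -/
def testFunAvg (Γ : Subgroup PSL(2, ℝ)) (κ : OnePoint ℝ) (σ : PSL(2, ℝ))
    (h : AddCircle (1 : ℝ) → Real.Angle → ℂ) (T η : ℝ) : UnitTangent → ℂ :=
  cuspSum Γ κ σ (cuspFunAvg h T η)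

/-- The point `(x + iy, 0)` of the horocycle at height `y`. -/
def horoPt (y : ℝ) (hy : 0 < y) (x : ℝ) : UnitTangent := ⟨⟨⟨x, y⟩, hy⟩, 0⟩

end

/-! No equidistribution and no cancellation between `h` and its average is needed: each of the two
integrals is already `O(1/T)`, uniformly in `y`, and `1/T ≤ T ^ (-δ)`.

A term of the automorphic sum, with bottom row `(c, d)` of `σ⁻¹γ`, can be nonzero at `x + iy` only
if `Im (σ⁻¹γ(x + iy)) ≥ t`, where `t` is comparable to `T`. For `c = 0` this fails because the
horocycle lies below the cutoff. For `c ≠ 0` it puts `x + iy` in a horoball tangent to the real line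
at `r = -d/c`. Such a horoball meets the horocycle only if `|c| ≤ Q = 1/√(yt)`, and then in a
segment of half-width at most `(1/t) · 1/(Q|c|)`.

Shimizu's lemma (`shimizu_lemma`) gives `|c| ≥ 1` and `|c c'| |r - r'| ≥ 1` for distinct cosets.
Hence the intervals of length `1/(Q|c|)` centred at the points `r` are disjoint, and their total
length is at most that of a slightly enlarged `[α, β]` (`sum_inv_le_of_separated`). The factor `1/t`
is the gain, collected in `intervalIntegral_tsum_horoball_bound`. -/

/-! ### Shimizu's lemma -/

/-- This is the recursion of the first column `(a, c)` under `k ↦ k τ k⁻¹`, with `τ` the unit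
translation. The entry `c` is squared at each step, and once `a` is known to be bounded, `a c → 0`
forces `a → 1`. -/
theorem shimizu_tendsto {a c : ℕ → ℝ} (hc0 : |c 0| < 1)
    (ha : ∀ n, a (n + 1) = 1 - a n * c n) (hc : ∀ n, c (n + 1) = -(c n) ^ 2) :
    Filter.Tendsto c Filter.atTop (nhds 0) ∧ Filter.Tendsto a Filter.atTop (nhds 1) := by
  have hpow : ∀ n, |c n| ≤ |c 0| ^ (n + 1) := by
    intro n
    induction n with
    | zero => simp
    | succ n ih =>
      have h1 : |c n| ≤ |c 0| :=
        ih.trans (pow_le_of_le_one (abs_nonneg _) hc0.le (Nat.succ_ne_zero n))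
      rw [hc, abs_neg, abs_pow, sq, pow_succ]
      gcongr
  have htc : Filter.Tendsto c Filter.atTop (nhds 0) :=
    squeeze_zero_norm hpow
      ((tendsto_pow_atTop_nhds_zero_of_lt_one (abs_nonneg _) hc0).comp
        (Filter.tendsto_add_atTop_nat 1))
  have hle : ∀ n, |c n| ≤ |c 0| := fun n =>
    (hpow n).trans (pow_le_of_le_one (abs_nonneg _) hc0.le (Nat.succ_ne_zero n))
  -- The number `1 / (1 - |c 0|)` is the fixed point of `s ↦ 1 + s |c 0|`, which makes the bound
  -- stable under the recursion.
  have hbd : ∀ n, |a n| ≤ |a 0| + 1 / (1 - |c 0|) := by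
    have h1 : 0 < 1 - |c 0| := by linarith
    intro n
    induction n with
    | zero => have : 0 ≤ 1 / (1 - |c 0|) := by positivity
              linarith
    | succ n ih =>
      have h2 : |a (n + 1)| ≤ 1 + |a n| * |c n| := by
        rw [ha, ← abs_mul]
        simpa using abs_sub (1 : ℝ) (a n * c n)
      have h3 : |a n| * |c n| ≤ (|a 0| + 1 / (1 - |c 0|)) * |c 0| :=
        mul_le_mul ih (hle n) (abs_nonneg _) (by positivity)
      have h4 : 1 / (1 - |c 0|) * |c 0| = 1 / (1 - |c 0|) - 1 := by field_simp; ring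
      have h5 : |a 0| * |c 0| ≤ |a 0| := mul_le_of_le_one_right (abs_nonneg _) hc0.le
      linarith
  have hac : Filter.Tendsto (fun n => a n * c n) Filter.atTop (nhds 0) := by
    refine squeeze_zero_norm (a := fun n => (|a 0| + 1 / (1 - |c 0|)) * |c n|) (fun n => ?_) ?_
    · rw [Real.norm_eq_abs, abs_mul]
      gcongr
      exact hbd n
    · simpa using htc.abs.const_mul (|a 0| + 1 / (1 - |c 0|))
  refine ⟨htc, (Filter.tendsto_add_atTop_iff_nat 1).mp ?_⟩
  simpa [ha] using hac.const_sub 1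

theorem translationMatrix_apply_one_zero (b : ℝ) : translationMatrix b 1 0 = 0 := by
  simp [translationMatrix]

theorem translationMatrix_apply_one_one (b : ℝ) : translationMatrix b 1 1 = 1 := by
  simp [translationMatrix]

/-- All four entries depend only on the first column of `g`, so convergence of that column controls
the whole iterated matrix. -/
theorem mul_translation_mul_inv_apply (g : SL(2, ℝ)) :
    (g * translationMatrix 1 * g⁻¹) 0 0 = 1 - g 0 0 * g 1 0 ∧
    (g * translationMatrix 1 * g⁻¹) 0 1 = g 0 0 ^ 2 ∧
    (g * translationMatrix 1 * g⁻¹) 1 0 = -(g 1 0) ^ 2 ∧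
    (g * translationMatrix 1 * g⁻¹) 1 1 = 1 + g 0 0 * g 1 0 := by
  have hd := g.det_coe
  rw [Matrix.det_fin_two] at hd
  rw [Matrix.SpecialLinearGroup.coe_mul, Matrix.SpecialLinearGroup.coe_mul,
    Matrix.SpecialLinearGroup.coe_inv, Matrix.adjugate_fin_two]
  simp only [translationMatrix, Matrix.mul_apply, Fin.sum_univ_two, Matrix.of_apply,
    Matrix.cons_val', Matrix.cons_val_zero, Matrix.cons_val_one, Matrix.cons_val_fin_one]
  refine ⟨?_, ?_, ?_, ?_⟩
  · linear_combination hd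
  · ring
  · ring
  · linear_combination hd

theorem mk_eq_mk_iff (g k : SL(2, ℝ)) :
    (QuotientGroup.mk g : PSL(2, ℝ)) = QuotientGroup.mk k ↔ k = g ∨ k = -g := by
  rw [QuotientGroup.eq]
  constructor
  · intro h
    rcases sl_center_eq h with h | h
    · left; exact (inv_mul_eq_one.mp h).symm
    · right; rw [inv_mul_eq_iff_eq_mul] at h; simpa using h
  · rintro (rfl | rfl)
    · simp
    · have : g⁻¹ * -g = -1 := by simp
      rw [this]
      exact Matrix.SpecialLinearGroup.mem_center_iff.mpr
          ⟨-1, by simp, by ext i j; fin_cases i <;> fin_cases j <;> simp⟩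

/-- Shimizu's lemma for a discrete group with `∞` moved by `σ` to a cusp of width one. -/
theorem shimizu_lemma {Γ : Subgroup PSL(2, ℝ)} (hΓ : DiscreteTopology Γ) (σ : PSL(2, ℝ))
    (hτ : σ * (QuotientGroup.mk (translationMatrix 1) : PSL(2, ℝ)) * σ⁻¹ ∈ Γ)
    (g : SL(2, ℝ)) (hg : σ * (QuotientGroup.mk g : PSL(2, ℝ)) * σ⁻¹ ∈ Γ) :
    g 1 0 = 0 ∨ 1 ≤ |g 1 0| := by
  by_contra! hcon
  obtain ⟨hne, hlt⟩ := hcon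
  let u : ℕ → SL(2, ℝ) := fun n => (fun k => k * translationMatrix 1 * k⁻¹)^[n] g
  have hu : ∀ n, u (n + 1) = u n * translationMatrix 1 * (u n)⁻¹ := fun n =>
    Function.iterate_succ_apply' _ _ _
  have hc : ∀ n, u (n + 1) 1 0 = -(u n 1 0) ^ 2 := fun n => by
    rw [hu]; exact (mul_translation_mul_inv_apply _).2.2.1
  obtain ⟨htc, hta⟩ := shimizu_tendsto (a := fun n => u n 0 0) (c := fun n => u n 1 0) hlt
    (fun n => by simp only [hu]; exact (mul_translation_mul_inv_apply _).1) hc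
  have hac : Filter.Tendsto (fun n => u n 0 0 * u n 1 0) Filter.atTop (nhds 0) := by
    simpa using hta.mul htc
  have hlim : Filter.Tendsto (fun n => u (n + 1)) Filter.atTop (nhds (translationMatrix 1)) := by
    refine tendsto_subtype_rng.mpr (tendsto_pi_nhds.mpr ?_)
    intro i
    rw [tendsto_pi_nhds]
    intro k
    have e := fun n => hu n ▸ mul_translation_mul_inv_apply (u n)
    fin_cases i <;> fin_cases k
    · refine Filter.Tendsto.congr (fun n => (e n).1.symm) ?_
      simpa [translationMatrix] using hac.const_sub 1
    · refine Filter.Tendsto.congr (fun n => (e n).2.1.symm) ?_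
      simpa [translationMatrix] using hta.pow 2
    · refine Filter.Tendsto.congr (fun n => (e n).2.2.1.symm) ?_
      simpa [translationMatrix] using (htc.pow 2).neg
    · refine Filter.Tendsto.congr (fun n => (e n).2.2.2.symm) ?_
      simpa [translationMatrix] using hac.const_add 1
  have hmem : ∀ n, σ * (QuotientGroup.mk (u n) : PSL(2, ℝ)) * σ⁻¹ ∈ Γ := by
    intro n
    induction n with
    | zero => exact hg
    | succ n ih =>
      have := Γ.mul_mem (Γ.mul_mem ih hτ) (Γ.inv_mem ih)
      convert this using 1
      rw [hu, QuotientGroup.mk_mul, QuotientGroup.mk_mul, QuotientGroup.mk_inv]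
      group
  have hlim2 : Filter.Tendsto (fun n => σ * (QuotientGroup.mk (u (n + 1)) : PSL(2, ℝ)) * σ⁻¹)
      Filter.atTop (nhds (σ * (QuotientGroup.mk (translationMatrix 1) : PSL(2, ℝ)) * σ⁻¹)) := by
    have hcont : Continuous fun k : SL(2, ℝ) => σ * (QuotientGroup.mk k : PSL(2, ℝ)) * σ⁻¹ :=
      ((continuous_const_mul σ).comp QuotientGroup.continuous_mk) |> fun h => (continuous_mul_const σ⁻¹).comp h
    exact (hcont.tendsto _).comp hlim
  have hlim3 : Filter.Tendsto (fun n => (⟨_, hmem (n + 1)⟩ : Γ)) Filter.atTop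
      (nhds (⟨_, hτ⟩ : Γ)) := tendsto_subtype_rng.mpr hlim2
  -- In a discrete group the convergent sequence eventually equals its limit `τ`. This forces a
  -- lower-left entry to vanish, whereas repeated squaring of a nonzero number never gives zero.
  rw [nhds_discrete, Filter.tendsto_pure] at hlim3
  obtain ⟨n, hn⟩ := hlim3.exists
  have h1 := mul_left_cancel (mul_right_cancel (Subtype.ext_iff.mp hn))
  have hzero : u (n + 1) 1 0 = 0 := by
    rcases (mk_eq_mk_iff _ _).mp h1.symm with h | h <;>
      simp [h, Matrix.SpecialLinearGroup.coe_neg, translationMatrix_apply_one_zero]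
  have hall : ∀ n, u n 1 0 ≠ 0 := by
    intro n
    induction n with
    | zero => exact hne
    | succ n ih => rw [hc]; simpa using ih
  exact hall _ hzero

/-! ### Packing of horoballs along a horocycle -/

/-- The summands are lengths of disjoint intervals centred at the `r i`. Since `Q |c i| ≥ 1`, each
has half-length at most `1/2`, so all fit in `[A - 1/2, B + 1/2]`. -/
theorem sum_inv_le_of_separated {ι : Type*} (s : Finset ι) (c r : ι → ℝ) {Q A B : ℝ}
    (hAB : A ≤ B) (hc : ∀ i ∈ s, 1 ≤ |c i|) (hQ : ∀ i ∈ s, |c i| ≤ Q)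
    (hr : ∀ i ∈ s, r i ∈ Set.Icc A B)
    (hsep : ∀ i ∈ s, ∀ k ∈ s, i ≠ k → 1 ≤ |c i| * |c k| * |r i - r k|) :
    ∑ i ∈ s, 1 / (Q * |c i|) ≤ B - A + 1 := by
  have hQ1 : ∀ i ∈ s, 1 ≤ Q := fun i hi => (hc i hi).trans (hQ i hi)
  let w : ι → ℝ := fun i => 1 / (2 * (Q * |c i|))
  have hw : ∀ i ∈ s, 0 ≤ w i ∧ w i ≤ 1 / 2 := by
    intro i hi
    have h1 := hQ1 i hi
    have h2 := hc i hi
    refine ⟨by positivity, one_div_le_one_div_of_le (by norm_num) ?_⟩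
    nlinarith
  have hdisj : (s : Set ι).PairwiseDisjoint fun i => Set.Ioo (r i - w i) (r i + w i) := by
    intro i hi k hk hik
    rw [Function.onFun, Set.disjoint_left]
    rintro x ⟨h1, h2⟩ ⟨h3, h4⟩
    have hci : 0 < |c i| := one_pos.trans_le (hc i hi)
    have hck : 0 < |c k| := one_pos.trans_le (hc k hk)
    have hlt : |r i - r k| < w i + w k := by rw [abs_lt]; constructor <;> linarith
    -- Replacing `Q` by the smaller `|c k|` (below, by `|c i|`) bounds each half-length by half the
    -- guaranteed gap between the centres.
    have e1 : w i ≤ 1 / (2 * (|c i| * |c k|)) := by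
      have := hQ k hk
      apply one_div_le_one_div_of_le (by positivity)
      nlinarith
    have e2 : w k ≤ 1 / (2 * (|c i| * |c k|)) := by
      have := hQ i hi
      apply one_div_le_one_div_of_le (by positivity)
      nlinarith
    have e3 : 1 / (|c i| * |c k|) ≤ |r i - r k| := by
      rw [div_le_iff₀' (by positivity)]; exact hsep i hi k hk hik
    have e4 : 1 / (2 * (|c i| * |c k|)) + 1 / (2 * (|c i| * |c k|)) = 1 / (|c i| * |c k|) := by
      field_simp; norm_num
    linarith
  have hvol := measureReal_biUnion_finset (μ := (volume : Measure ℝ)) hdisj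
    (fun i _ => measurableSet_Ioo) (fun i _ => by simp)
  have hsub : (⋃ i ∈ s, Set.Ioo (r i - w i) (r i + w i)) ⊆ Set.Icc (A - 1 / 2) (B + 1 / 2) := by
    refine Set.iUnion₂_subset fun i hi x hx => ?_
    have h1 := hw i hi
    have h2 := hr i hi
    exact ⟨by linarith [hx.1, h2.1], by linarith [hx.2, h2.2]⟩
  have hle := measureReal_mono (μ := (volume : Measure ℝ)) hsub (by simp)
  rw [hvol, Real.volume_real_Icc_of_le (by linarith)] at hle
  calc ∑ i ∈ s, 1 / (Q * |c i|) = ∑ i ∈ s, volume.real (Set.Ioo (r i - w i) (r i + w i)) := by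
        refine Finset.sum_congr rfl fun i hi => ?_
        rw [Real.volume_real_Ioo_of_le (by linarith [(hw i hi).1])]
        simp only [w]
        have : 0 < |c i| := one_pos.trans_le (hc i hi)
        have := hQ1 i hi
        field_simp
        ring
    _ ≤ B - A + 1 := by linarith

/-- Every summand in the packing bound is at least `1/Q²`, which limits the number of indices. -/
theorem finite_of_separated {ι : Type*} (R : Set ι) (c r : ι → ℝ) {Q A B : ℝ}
    (hAB : A ≤ B) (hc : ∀ i ∈ R, 1 ≤ |c i|) (hQ : ∀ i ∈ R, |c i| ≤ Q)
    (hr : ∀ i ∈ R, r i ∈ Set.Icc A B)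
    (hsep : ∀ i ∈ R, ∀ k ∈ R, i ≠ k → 1 ≤ |c i| * |c k| * |r i - r k|) : R.Finite := by
  by_contra hinf
  obtain ⟨n, hn⟩ := exists_nat_gt ((B - A + 1) * (Q * Q))
  obtain ⟨s, hsR, hs⟩ := Set.Infinite.exists_subset_card_eq hinf (n + 1)
  have key := sum_inv_le_of_separated s c r hAB (fun i hi => hc i (hsR hi))
    (fun i hi => hQ i (hsR hi)) (fun i hi => hr i (hsR hi))
    (fun i hi k hk => hsep i (hsR hi) k (hsR hk))
  obtain ⟨i₀, hi₀⟩ : s.Nonempty := Finset.card_pos.mp (by omega)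
  have hQ1 : 1 ≤ Q := (hc _ (hsR hi₀)).trans (hQ _ (hsR hi₀))
  have hlow : (s.card : ℝ) * (1 / (Q * Q)) ≤ ∑ i ∈ s, 1 / (Q * |c i|) := by
    rw [← nsmul_eq_mul]
    refine Finset.card_nsmul_le_sum _ _ _ fun i hi => ?_
    have h1 := hc i (hsR hi)
    have h2 := hQ i (hsR hi)
    apply one_div_le_one_div_of_le (by positivity)
    gcongr
  have h3 := hlow.trans key
  rw [mul_one_div, div_le_iff₀ (by positivity), hs] at h3
  push_cast at h3
  linarith

/-- Horizontal section at height `y` of the horoball of radius parameter `t` at `r`. -/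
theorem abs_sub_le_of_horoball {c r x y t : ℝ} (hc : 1 ≤ |c|) (hy : 0 < y) (ht : 0 < t)
    (h : t * (c ^ 2 * ((x - r) ^ 2 + y ^ 2)) ≤ y) :
    |c| ≤ 1 / √(y * t) ∧ |x - r| ≤ 1 / t * (1 / (1 / √(y * t) * |c|)) := by
  have hyt : 0 < y * t := by positivity
  have hs := Real.sqrt_pos.mpr hyt
  have hsq := Real.sq_sqrt hyt.le
  have hcc : |c| ^ 2 = c ^ 2 := sq_abs c
  set u := √(y * t)
  have hc0 : 0 < |c| := by linarith
  -- Discarding `(x - r)²` from the hypothesis bounds `|c|`; discarding `y²` bounds `|x - r|` by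
  -- `√(y/t)/|c|`, which is `1/t` times the packing length `1/(Q|c|)`.
  constructor
  · rw [le_div_iff₀ hs]
    apply (pow_le_pow_iff_left₀ (by positivity) (by positivity) two_ne_zero).mp
    have h1 : t * (c ^ 2 * y ^ 2) ≤ y := by
      refine le_trans ?_ h
      gcongr
      nlinarith [sq_nonneg (x - r)]
    rw [mul_pow, hcc, hsq]
    by_contra! hlt
    nlinarith
  · have e : 1 / t * (1 / (1 / u * |c|)) = u / (t * |c|) := by field_simp
    rw [e, le_div_iff₀ (by positivity)]
    apply (pow_le_pow_iff_left₀ (by positivity) (by positivity) two_ne_zero).mp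
    rw [mul_pow, mul_pow, hcc, hsq, sq_abs]
    have h1 : t * (c ^ 2 * (x - r) ^ 2) ≤ y := by
      refine le_trans ?_ h
      gcongr
      nlinarith [sq_nonneg y]
    nlinarith

theorem norm_setIntegral_le_of_support_subset {F : ℝ → ℂ} {K r w α β : ℝ} (hK : 0 ≤ K)
    (hw : 0 ≤ w) (hF : ∀ x, ‖F x‖ ≤ K)
    (hs : ∀ x ∈ Set.Ioc α β, F x ≠ 0 → |x - r| ≤ w) :
    ‖∫ x in Set.Ioc α β, F x‖ ≤ K * (2 * w) := by
  have hint : Integrable ((Set.Icc (r - w) (r + w)).indicator fun _ => K) (volume : Measure ℝ) :=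
    (integrable_indicator_iff measurableSet_Icc).mpr (by simp)
  have hnn : ∀ x, 0 ≤ (Set.Icc (r - w) (r + w)).indicator (fun _ => K) x :=
    Set.indicator_nonneg fun _ _ => hK
  calc ‖∫ x in Set.Ioc α β, F x‖
      ≤ ∫ x in Set.Ioc α β, (Set.Icc (r - w) (r + w)).indicator (fun _ => K) x := by
        refine norm_integral_le_of_norm_le hint.integrableOn ?_
        refine (ae_restrict_iff' measurableSet_Ioc).mpr (Filter.Eventually.of_forall ?_)
        intro x hx
        by_cases h0 : F x = 0
        · rw [h0, norm_zero]; exact hnn x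
        · have := abs_le.mp (hs x hx h0)
          rw [Set.indicator_of_mem (Set.mem_Icc.mpr ⟨by linarith, by linarith⟩)]
          exact hF x
    _ ≤ ∫ x, (Set.Icc (r - w) (r + w)).indicator (fun _ => K) x :=
        setIntegral_le_integral hint (Filter.Eventually.of_forall hnn)
    _ = K * (2 * w) := by
        rw [integral_indicator measurableSet_Icc, setIntegral_const,
          Real.volume_real_Icc_of_le (by linarith), smul_eq_mul]
        ring

/-- Only finitely many horoballs meet the segment, so sum and integral commute. Each contributes at
most `K` times its chord, and the chords add up to at most `2/t` times the packing bound. -/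
theorem intervalIntegral_tsum_horoball_bound {ι : Type*} (F : ι → ℝ → ℂ) (c r : ι → ℝ)
    {K y t α β : ℝ} (hK : 0 ≤ K) (hy : 0 < y) (ht : 1 / 2 ≤ t) (hαβ : α ≤ β)
    (hmeas : ∀ i, Measurable (F i)) (hF : ∀ i x, ‖F i x‖ ≤ K)
    (hc : ∀ i, c i ≠ 0 → 1 ≤ |c i|)
    (hsep : ∀ i k, i ≠ k → c i ≠ 0 → c k ≠ 0 → 1 ≤ |c i| * |c k| * |r i - r k|)
    (hsupp : ∀ i x, F i x ≠ 0 → c i ≠ 0 ∧ t * (c i ^ 2 * ((x - r i) ^ 2 + y ^ 2)) ≤ y) :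
    IntervalIntegrable (fun x => ∑' i, F i x) volume α β ∧
      ‖∫ x in α..β, ∑' i, F i x‖ ≤ 2 * K * (β - α + 5) / t := by
  have ht0 : 0 < t := by linarith
  set Q := 1 / √(y * t) with hQdef
  -- The margin `2` bounds the half-chord: `1/t ≤ 2` and `Q |c i| ≥ 1`. With the `1` from the
  -- packing bound it yields `β - α + 5`.
  let R : Set ι := {i | c i ≠ 0 ∧ |c i| ≤ Q ∧ r i ∈ Set.Icc (α - 2) (β + 2)}
  have hRsep : ∀ i ∈ R, ∀ k ∈ R, i ≠ k → 1 ≤ |c i| * |c k| * |r i - r k| :=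
    fun i hi k hk hik => hsep i k hik hi.1 hk.1
  have hRfin : R.Finite := finite_of_separated R c r (Q := Q) (A := α - 2) (B := β + 2)
    (by linarith) (fun i hi => hc i hi.1) (fun i hi => hi.2.1) (fun i hi => hi.2.2) hRsep
  have hchord : ∀ i x, F i x ≠ 0 → |c i| ≤ Q ∧ |x - r i| ≤ 1 / t * (1 / (Q * |c i|)) :=
    fun i x hx => abs_sub_le_of_horoball (hc i (hsupp i x hx).1) hy ht0 (hsupp i x hx).2
  have hmem : ∀ x ∈ Set.Ioc α β, ∀ i, F i x ≠ 0 → i ∈ R := by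
    intro x hx i hi
    have h1 := hchord i x hi
    have h2 := hc i (hsupp i x hi).1
    have h3 : 1 / t * (1 / (Q * |c i|)) ≤ 2 * 1 := by
      gcongr
      · rw [div_le_iff₀ ht0]; linarith
      · rw [div_le_one (by nlinarith)]; nlinarith
    have h4 := abs_le.mp (h1.2.trans h3)
    exact ⟨(hsupp i x hi).1, h1.1, by linarith [hx.1], by linarith [hx.2]⟩
  have hsum : ∀ x ∈ Set.Ioc α β, ∑' i, F i x = ∑ i ∈ hRfin.toFinset, F i x := by
    intro x hx
    refine tsum_eq_sum fun i hi => ?_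
    by_contra h0
    exact hi (hRfin.mem_toFinset.mpr (hmem x hx i h0))
  have hint : ∀ i, IntegrableOn (F i) (Set.Ioc α β) volume := fun i =>
    Measure.integrableOn_of_bounded (M := K) (by simp)
      (hmeas i).aestronglyMeasurable (Filter.Eventually.of_forall (hF i))
  constructor
  · rw [intervalIntegrable_iff_integrableOn_Ioc_of_le hαβ]
    exact (integrableOn_congr_fun hsum measurableSet_Ioc).mpr
      (integrable_finsetSum _ fun i _ => hint i)
  · rw [intervalIntegral.integral_of_le hαβ, setIntegral_congr_fun measurableSet_Ioc hsum,
      integral_finsetSum _ fun i _ => hint i]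
    calc ‖∑ i ∈ hRfin.toFinset, ∫ x in Set.Ioc α β, F i x‖
        ≤ ∑ i ∈ hRfin.toFinset, 2 * K / t * (1 / (Q * |c i|)) := by
          refine norm_sum_le_of_le _ fun i _ => ?_
          have hQ0 : 0 < Q := by positivity
          refine (norm_setIntegral_le_of_support_subset hK (w := 1 / t * (1 / (Q * |c i|)))
            (by positivity) (hF i) fun x _ hx => (hchord i x hx).2).trans_eq (by ring)
      _ = 2 * K / t * ∑ i ∈ hRfin.toFinset, 1 / (Q * |c i|) := by rw [Finset.mul_sum]
      _ ≤ 2 * K / t * ((β + 2) - (α - 2) + 1) := by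
          gcongr
          have hR : ∀ i ∈ hRfin.toFinset, i ∈ R := fun i hi => hRfin.mem_toFinset.mp hi
          exact sum_inv_le_of_separated _ c r (by linarith) (fun i hi => hc i (hR i hi).1)
            (fun i hi => (hR i hi).2.1) (fun i hi => (hR i hi).2.2)
            fun i hi k hk => hRsep i (hR i hi) k (hR k hk)
      _ = 2 * K * (β - α + 5) / t := by ring

/-! ### Size and support of the cutoff -/

theorem abs_mollifier_le (x : ℝ) :
    |mollifier x| ≤ (Set.Icc (-1 : ℝ) 1).indicator (fun _ => |mollifierNorm⁻¹|) x := by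
  rw [mollifier]
  split_ifs with h
  · have h1 := abs_lt.mp h
    rw [Set.indicator_of_mem (Set.mem_Icc.mpr ⟨h1.1.le, h1.2.le⟩), abs_mul, Real.abs_exp]
    refine mul_le_of_le_one_right (abs_nonneg _) (Real.exp_le_one_iff.mpr ?_)
    refine div_nonpos_of_nonpos_of_nonneg (by norm_num) ?_
    nlinarith
  · rw [abs_zero]
    exact Set.indicator_nonneg (fun _ _ => abs_nonneg _) x

theorem measurable_mollifier : Measurable mollifier := by
  unfold mollifier
  exact Measurable.ite (measurableSet_lt measurable_id.abs measurable_const)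
    (by fun_prop) measurable_const

theorem integrable_mollifier : Integrable mollifier := by
  refine Integrable.mono' (g := (Set.Icc (-1 : ℝ) 1).indicator (fun _ => |mollifierNorm⁻¹|)) ?_
    measurable_mollifier.aestronglyMeasurable (Filter.Eventually.of_forall abs_mollifier_le)
  exact (integrable_indicator_iff measurableSet_Icc).mpr (by simp)

theorem integrable_mollifierScaled {ε : ℝ} (hε : 0 < ε) : Integrable (mollifierScaled ε) :=
  (integrable_mollifier.comp_div hε.ne').const_mul _

theorem integral_abs_mollifierScaled {ε : ℝ} (hε : 0 < ε) :
    ∫ s, |mollifierScaled ε s| = ∫ s, |mollifier s| := by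
  have : (fun s => |mollifierScaled ε s|) = fun s => 1 / ε * |mollifier (s / ε)| := by
    funext s
    rw [mollifierScaled, abs_mul, abs_of_pos (by positivity : 0 < 1 / ε)]
  rw [this, integral_const_mul, Measure.integral_comp_div (fun s => |mollifier s|), abs_of_pos hε,
    smul_eq_mul]
  field_simp

theorem abs_indicator_one_le (s : Set ℝ) (x : ℝ) : |s.indicator (1 : ℝ → ℝ) x| ≤ 1 := by
  by_cases h : x ∈ s <;> simp [h]

/-- The `L¹` norm of the mollifier is invariant under scaling, so the bound is uniform in `η`; the
summand `1` covers the sharp cutoff. -/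
theorem abs_cuspCutoff_le (T η y : ℝ) : |cuspCutoff T η y| ≤ 1 + ∫ s, |mollifier s| := by
  have hnn : 0 ≤ ∫ s, |mollifier s| := integral_nonneg fun _ => abs_nonneg _
  rw [cuspCutoff]
  split_ifs with h
  · linarith [abs_indicator_one_le (Set.Ici T) y]
  · have hε : 0 < |η| / 2 := by positivity
    rw [← integral_abs_mollifierScaled hε]
    refine le_add_of_nonneg_of_le zero_le_one ?_
    rw [← Real.norm_eq_abs]
    refine norm_integral_le_of_norm_le (integrable_mollifierScaled hε).abs
      (Filter.Eventually.of_forall fun s => ?_)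
    rw [norm_mul]
    exact mul_le_of_le_one_left (abs_nonneg _) (abs_indicator_one_le _ _)

/-- The jump sits at `y = T + η/2 + s` with `|s| < |η|/2`, hence never below `T - |η|`. -/
theorem cuspCutoff_eq_zero {T η y : ℝ} (h : y < T - |η|) : cuspCutoff T η y = 0 := by
  rw [cuspCutoff]
  split_ifs with h0
  · rw [Set.indicator_of_notMem]
    rw [h0, abs_zero] at h
    simpa using h
  · refine integral_eq_zero_of_ae (Filter.Eventually.of_forall fun s => ?_)
    have hε : 0 < |η| / 2 := by positivity
    by_cases hs : |s / (|η| / 2)| < 1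
    · rw [abs_div, abs_of_pos hε, div_lt_one hε] at hs
      have h1 := abs_lt.mp hs
      have h2 := neg_abs_le η
      have h3 : y - 2 * T - s ∉ Set.Ici (-T + η / 2) := by
        rw [Set.mem_Ici, not_le]
        linarith
      simp only [Set.indicator_of_notMem h3, zero_mul, Pi.zero_apply]
    · simp only [mollifierScaled, mollifier, if_neg hs, mul_zero, Pi.zero_apply]

theorem measurable_cuspCutoff (T η : ℝ) : Measurable (cuspCutoff T η) := by
  unfold cuspCutoff
  by_cases h : η = 0
  · simp only [h, if_true]
    exact measurable_one.indicator measurableSet_Ici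
  · simp only [h, if_false]
    have hm : Measurable fun p : ℝ × ℝ =>
        (Set.Ici (-T + η / 2)).indicator (1 : ℝ → ℝ) (p.1 - 2 * T - p.2) *
          mollifierScaled (|η| / 2) p.2 := by
      have h1 : Measurable ((Set.Ici (-T + η / 2)).indicator (1 : ℝ → ℝ)) :=
        measurable_one.indicator measurableSet_Ici
      have h2 : Measurable (mollifierScaled (|η| / 2)) :=
        (measurable_mollifier.comp (measurable_id.div_const _)).const_mul _
      exact (h1.comp (by fun_prop)).mul (h2.comp measurable_snd)
    exact (hm.stronglyMeasurable.integral_prod_right).measurable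

theorem SmoothOnTorus.exists_bound {h : AddCircle (1 : ℝ) → Real.Angle → ℂ}
    (hh : SmoothOnTorus h) : ∃ H : ℝ, 0 ≤ H ∧ ∀ x θ, ‖h x θ‖ ≤ H := by
  obtain ⟨H, hH⟩ := ((isCompact_Icc (a := (0 : ℝ)) (b := 1)).prod
    (isCompact_Icc (a := -Real.pi) (b := Real.pi))).exists_bound_of_continuousOn
      hh.continuous.continuousOn
  have key : ∀ x θ, ‖h x θ‖ ≤ H := by
    intro x θ
    obtain ⟨a, ha, rfl⟩ : ∃ a ∈ Set.Icc (0 : ℝ) 1, (a : AddCircle (1 : ℝ)) = x := by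
      have := AddCircle.coe_image_Icc_eq (1 : ℝ) 0
      have hx : x ∈ (Set.univ : Set (AddCircle (1 : ℝ))) := trivial
      rw [← this] at hx
      simpa using hx
    rw [← Real.Angle.coe_toReal θ]
    exact hH (a, θ.toReal) ⟨ha, (Real.Angle.neg_pi_lt_toReal θ).le, Real.Angle.toReal_le_pi θ⟩
  exact ⟨H, (norm_nonneg _).trans (key 0 0), key⟩

/-! ### The Möbius action along a horocycle -/

theorem psl_smul_infty_eq_self_iff (g : SL(2, ℝ)) :
    (QuotientGroup.mk g : PSL(2, ℝ)) • (OnePoint.infty : OnePoint ℝ) = OnePoint.infty ↔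
      g 1 0 = 0 := by
  rw [psl_smul_onePoint, OnePoint.smul_infty_eq_self_iff]
  rfl

theorem sl_smul_im (g : SL(2, ℝ)) (z : ℍ) :
    (g • z).im = z.im / Complex.normSq (slDenom g z) := by
  have := UpperHalfPlane.im_smul_eq_div_normSq (Matrix.SpecialLinearGroup.mapGL (R := ℝ) ℝ g) z
  rw [slDenom_eq]
  refine Eq.trans this ?_
  simp

theorem normSq_slDenom_horoPt (g : SL(2, ℝ)) {y : ℝ} (hy : 0 < y) (x : ℝ) :
    Complex.normSq (slDenom g (horoPt y hy x).pt) =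
      (g 1 0 * x + g 1 1) ^ 2 + (g 1 0 * y) ^ 2 := by
  simp [slDenom, horoPt, Complex.normSq_apply]
  ring

theorem continuous_horoPt_pt {y : ℝ} (hy : 0 < y) : Continuous fun x => (horoPt y hy x).pt := by
  rw [UpperHalfPlane.isEmbedding_coe.continuous_iff]
  have : (UpperHalfPlane.coe ∘ fun x => (horoPt y hy x).pt) =
      fun x : ℝ => (x : ℂ) + y * Complex.I := by
    funext x
    apply Complex.ext <;> simp [horoPt]
  rw [this]
  fun_prop

/-- The function is composed with the real-valued lift `-2 arg (cx + d + icy)` of the angle, so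
continuity of `k` on the universal cover suffices. -/
theorem measurable_cuspFun_smul_horoPt {k : AddCircle (1 : ℝ) → Real.Angle → ℂ}
    (hk : Continuous fun p : ℝ × ℝ => k (p.1 : AddCircle (1 : ℝ)) (p.2 : Real.Angle))
    (T η : ℝ) {y : ℝ} (hy : 0 < y) (g : SL(2, ℝ)) :
    Measurable fun x => cuspFun k T η ((QuotientGroup.mk g : PSL(2, ℝ)) • horoPt y hy x) := by
  have hz := continuous_horoPt_pt hy
  have hgz : Continuous fun x => g • (horoPt y hy x).pt := hz.const_smul g
  have hden : Measurable fun x => slDenom g (horoPt y hy x).pt := by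
    have : Continuous fun x => slDenom g (horoPt y hy x).pt := by
      unfold slDenom
      exact (continuous_const.mul (UpperHalfPlane.continuous_coe.comp hz)).add continuous_const
    exact this.measurable
  have h1 : Measurable fun x => cuspCutoff T η (g • (horoPt y hy x).pt).im :=
    (measurable_cuspCutoff T η).comp (UpperHalfPlane.continuous_im.comp hgz).measurable
  have h2 : Measurable fun x => ((g • (horoPt y hy x).pt).re,
      -(2 * Complex.arg (slDenom g (horoPt y hy x).pt))) :=
    (UpperHalfPlane.continuous_re.comp hgz).measurable.prodMk
      ((Complex.measurable_arg.comp hden).const_mul 2).neg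
  have h3 := (Complex.measurable_ofReal.comp h1).mul (hk.measurable.comp h2)
  convert h3 using 2 with x
  rw [psl_smul_unitTangent]
  simp [cuspFun, horoPt]

theorem norm_cuspFun_le {k : AddCircle (1 : ℝ) → Real.Angle → ℂ} {H : ℝ}
    (hH : ∀ x θ, ‖k x θ‖ ≤ H) (T η : ℝ) (p : UnitTangent) :
    ‖cuspFun k T η p‖ ≤ (1 + ∫ s, |mollifier s|) * H := by
  rw [cuspFun, norm_mul, Complex.norm_real]
  have := abs_cuspCutoff_le T η p.pt.im
  exact mul_le_mul this (hH _ _) (norm_nonneg _) ((abs_nonneg _).trans this)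

theorem le_im_of_cuspFun_ne_zero {k : AddCircle (1 : ℝ) → Real.Angle → ℂ} {T η : ℝ}
    {p : UnitTangent} (h : cuspFun k T η p ≠ 0) : T - |η| ≤ p.pt.im := by
  by_contra! hlt
  exact h (by simp [cuspFun, cuspCutoff_eq_zero hlt])

theorem mul_inv_apply_one_zero (g k : SL(2, ℝ)) :
    (g * k⁻¹) 1 0 = g 1 0 * k 1 1 - g 1 1 * k 1 0 := by
  rw [Matrix.SpecialLinearGroup.coe_mul, Matrix.SpecialLinearGroup.coe_inv,
    Matrix.adjugate_fin_two, Matrix.mul_apply, Fin.sum_univ_two]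
  simp
  ring

theorem continuous_torusAverage {h : AddCircle (1 : ℝ) → Real.Angle → ℂ}
    (hh : Continuous fun p : ℝ × ℝ => h (p.1 : AddCircle (1 : ℝ)) (p.2 : Real.Angle)) :
    Continuous fun p : ℝ × ℝ =>
      ∫ t in (0 : ℝ)..1, h (t : AddCircle (1 : ℝ)) (p.2 : Real.Angle) :=
  intervalIntegral.continuous_parametric_intervalIntegral_of_continuous'
    (f := fun (p : ℝ × ℝ) t => h (t : AddCircle (1 : ℝ)) (p.2 : Real.Angle))
    (hh.comp (continuous_snd.prodMk (continuous_snd.comp continuous_fst))) 0 1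

theorem norm_torusAverage_le {h : AddCircle (1 : ℝ) → Real.Angle → ℂ} {H : ℝ}
    (hH : ∀ x θ, ‖h x θ‖ ≤ H) (θ : Real.Angle) :
    ‖∫ t in (0 : ℝ)..1, h (t : AddCircle (1 : ℝ)) θ‖ ≤ H := by
  simpa using intervalIntegral.norm_integral_le_of_norm_le_const (a := 0) (b := 1)
    (f := fun t : ℝ => h (t : AddCircle (1 : ℝ)) θ) fun t _ => hH _ θ

/-! ### The horoball bound for automorphic sums -/

/-- Over a horocycle segment the automorphic sum of a cuspidal function supported above height `T`
has integral `O((β - α + 5) / T)`, uniformly in the height of the horocycle. -/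
theorem intervalIntegral_testFun_bound {Γ : Subgroup PSL(2, ℝ)} (hΓ : DiscreteTopology Γ)
    {κ : OnePoint ℝ} {σ : PSL(2, ℝ)} (hσ : IsScalingMatrix Γ κ σ)
    (hΓ_std : cuspStabilizer Γ OnePoint.infty = gammaInfty)
    (hκ : (κ = OnePoint.infty ∧ σ = 1) ∨ ∀ γ ∈ Γ, γ • OnePoint.infty ≠ κ)
    {k : AddCircle (1 : ℝ) → Real.Angle → ℂ}
    (hk : Continuous fun p : ℝ × ℝ => k (p.1 : AddCircle (1 : ℝ)) (p.2 : Real.Angle))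
    {H : ℝ} (hH : ∀ x θ, ‖k x θ‖ ≤ H) {T η y α β : ℝ} (hy : 0 < y) (hT : 1 < T)
    (hη : |η| ≤ 1 / 4) (hyT : y < T - |η|) (hαβ : α ≤ β) :
    IntervalIntegrable (fun x => testFun Γ κ σ k T η (horoPt y hy x)) volume α β ∧
      ‖∫ x in α..β, testFun Γ κ σ k T η (horoPt y hy x)‖ ≤
        2 * ((1 + ∫ s, |mollifier s|) * H) * (β - α + 5) / (T / 2) := by
  have hτ : (QuotientGroup.mk (translationMatrix 1) : PSL(2, ℝ)) ∈ gammaInfty := ⟨1, by simp⟩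
  have hτΓ : (QuotientGroup.mk (translationMatrix 1) : PSL(2, ℝ)) ∈ Γ :=
    (hΓ_std.symm ▸ hτ : _ ∈ cuspStabilizer Γ OnePoint.infty).1
  have hτσ : σ * (QuotientGroup.mk (translationMatrix 1) : PSL(2, ℝ)) * σ⁻¹ ∈ Γ := by
    rw [← hσ.conj_eq] at hτ
    obtain ⟨γ, hγ, he⟩ := hτ
    rw [← he]
    have : σ * (σ⁻¹ * γ * σ) * σ⁻¹ = γ := by group
    simpa [this] using hγ.1
  have hshimizu := shimizu_lemma hΓ σ hτσ
  let ι := Quotient (QuotientGroup.rightRel ((cuspStabilizer Γ κ).subgroupOf Γ))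
  choose g hg using fun i : ι =>
    QuotientGroup.mk_surjective (s := Subgroup.center SL(2, ℝ))
      (σ⁻¹ * ((Quotient.out i : Γ) : PSL(2, ℝ)) : PSL(2, ℝ))
  have hterm : ∀ (i : ι) (x : ℝ), cuspFun k T η
      (σ⁻¹ • (((Quotient.out i : Γ) : PSL(2, ℝ)) • horoPt y hy x)) =
      cuspFun k T η ((QuotientGroup.mk (g i) : PSL(2, ℝ)) • horoPt y hy x) := by
    intro i x
    rw [← mul_smul, ← hg]
  have hH0 : 0 ≤ H := (norm_nonneg _).trans (hH 0 0)
  have hM : 0 ≤ ∫ s, |mollifier s| := integral_nonneg fun _ => abs_nonneg _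
  have hsupp : ∀ (i : ι) (x : ℝ),
      cuspFun k T η ((QuotientGroup.mk (g i) : PSL(2, ℝ)) • horoPt y hy x) ≠ 0 →
      (T - |η|) * ((g i 1 0 * x + g i 1 1) ^ 2 + (g i 1 0 * y) ^ 2) ≤ y := by
    intro i x hx
    have h1 := le_im_of_cuspFun_ne_zero hx
    rw [psl_smul_unitTangent] at h1
    change T - |η| ≤ (g i • (horoPt y hy x).pt).im at h1
    rw [sl_smul_im, le_div_iff₀ (Complex.normSq_pos.mpr (slDenom_ne_zero _ _)),
      normSq_slDenom_horoPt] at h1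
    exact h1
  -- A vanishing `c` means that the coset representative sends `∞` to `κ`. By `hκ` this leaves `κ =
  -- ∞` and an integer translation, which keeps the point at height `y < T - |η|`, below the
  -- support.
  have hrow : ∀ (i : ι) (x : ℝ), g i 1 0 = 0 →
      cuspFun k T η ((QuotientGroup.mk (g i) : PSL(2, ℝ)) • horoPt y hy x) = 0 := by
    intro i x hi
    by_contra hx
    have hfix := (psl_smul_infty_eq_self_iff (g i)).mpr hi
    have hfix' : ((Quotient.out i : Γ) : PSL(2, ℝ)) • (OnePoint.infty : OnePoint ℝ) = κ := by
      refine Eq.trans ?_ hσ.smul_infty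
      rw [← inv_smul_eq_iff, ← mul_smul]
      exact (congrArg (· • (OnePoint.infty : OnePoint ℝ)) (hg i)).symm.trans hfix
    rcases hκ with ⟨rfl, rfl⟩ | hκ
    · have hmem : ((Quotient.out i : Γ) : PSL(2, ℝ)) ∈ gammaInfty := by
        rw [← hΓ_std]
        exact ⟨(Quotient.out i : Γ).2, hfix'⟩
      obtain ⟨b, hb⟩ := hmem
      have hgi := hg i
      rw [inv_one, one_mul, hb] at hgi
      have h11 : (g i 1 1) ^ 2 = 1 := by
        rcases (mk_eq_mk_iff _ _).mp hgi.symm with h | h <;>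
          simp [h, Matrix.SpecialLinearGroup.coe_neg, translationMatrix_apply_one_one]
      have := hsupp i x hx
      rw [hi] at this
      nlinarith
    · exact hκ _ (Quotient.out i : Γ).2 hfix'
  have hΓg : ∀ i l : ι, σ * (QuotientGroup.mk (g i * (g l)⁻¹) : PSL(2, ℝ)) * σ⁻¹ =
      ((Quotient.out i * (Quotient.out l)⁻¹ : Γ) : PSL(2, ℝ)) := by
    intro i l
    rw [QuotientGroup.mk_mul, QuotientGroup.mk_inv, hg, hg]
    push_cast
    group
  -- The matrix `g i` represents `σ⁻¹γ`, which need not lie in `σ⁻¹Γσ`, but `g i τ (g i)⁻¹` does,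
  -- since `τ ∈ Γ`. Its lower-left entry is `-c²`, and Shimizu's lemma applies to it.
  have hone : ∀ i : ι, g i 1 0 ≠ 0 → 1 ≤ |g i 1 0| := by
    intro i hi
    have hmem : σ * (QuotientGroup.mk (g i * translationMatrix 1 * (g i)⁻¹) : PSL(2, ℝ)) * σ⁻¹ ∈
        Γ := by
      have h1 := Γ.mul_mem (Γ.mul_mem (Quotient.out i : Γ).2 hτΓ) (Γ.inv_mem (Quotient.out i : Γ).2)
      convert h1 using 1
      rw [QuotientGroup.mk_mul, QuotientGroup.mk_mul, QuotientGroup.mk_inv, hg]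
      group
    have h1 := hshimizu _ hmem
    rw [(mul_translation_mul_inv_apply _).2.2.1, abs_neg, abs_pow] at h1
    rcases h1 with h1 | h1
    · exact absurd h1 (by simpa using hi)
    · exact (one_le_sq_iff₀ (abs_nonneg _)).mp h1
  -- This determinant is the lower-left entry of `g i (g l)⁻¹`, which does represent an element of
  -- `σ⁻¹Γσ`. It vanishes only when the two representatives differ by the stabilizer of `κ`, that
  -- is, for equal cosets.
  have hsep : ∀ i l : ι, i ≠ l → 1 ≤ |g i 1 0 * g l 1 1 - g i 1 1 * g l 1 0| := by
    intro i l hil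
    rw [← mul_inv_apply_one_zero]
    refine (hshimizu _ (by rw [hΓg]; exact Subtype.prop _)).resolve_left fun h0 => hil ?_
    have hfix := (psl_smul_infty_eq_self_iff _).mpr h0
    have hstab : ((Quotient.out i * (Quotient.out l)⁻¹ : Γ) : PSL(2, ℝ)) • κ = κ := by
      rw [← hΓg, ← hσ.smul_infty, mul_smul, mul_smul, inv_smul_smul]
      exact congrArg (σ • ·) hfix
    rw [← Quotient.out_eq i, ← Quotient.out_eq l]
    refine (Quotient.sound ?_).symm
    change QuotientGroup.rightRel _ _ _
    rw [QuotientGroup.rightRel_apply, Subgroup.mem_subgroupOf]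
    exact ⟨Subtype.prop _, hstab⟩
  simp only [testFun, cuspSum, hterm]
  -- Here `t = T/2`: as `T > 1` and `|η| ≤ 1/4`, both `T/2 ≤ T - |η|` and `1/2 ≤ T/2` hold.
  refine intervalIntegral_tsum_horoball_bound
    (fun i x => cuspFun k T η ((QuotientGroup.mk (g i) : PSL(2, ℝ)) • horoPt y hy x))
    (fun i => g i 1 0) (fun i => -(g i 1 1) / g i 1 0) (y := y) (by positivity) hy (by linarith)
    hαβ (fun i => measurable_cuspFun_smul_horoPt hk T η hy (g i))
    (fun i x => norm_cuspFun_le hH T η _) hone ?_ ?_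
  · intro i l hil hi hl
    rw [← abs_mul, ← abs_mul]
    convert hsep i l hil using 1
    congr 1
    field_simp
    ring
  · intro i x hx
    have hi : g i 1 0 ≠ 0 := fun h0 => hx (hrow i x h0)
    refine ⟨hi, le_trans ?_ (hsupp i x hx)⟩
    have e : g i 1 0 ^ 2 * ((x - -(g i 1 1) / g i 1 0) ^ 2 + y ^ 2) =
        (g i 1 0 * x + g i 1 1) ^ 2 + (g i 1 0 * y) ^ 2 := by
      field_simp
      ring
    rw [e]
    gcongr
    linarith

theorem mainTheorem3 (Γ : Subgroup PSL(2, ℝ)) (hΓ : IsCofiniteFuchsian Γ)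
    {q : ℕ} [NeZero q] (κ : Fin q → OnePoint ℝ)
    (hκ : ∀ j, IsCuspOf Γ (κ j))
    (hκ_ineq : ∀ i j, i ≠ j → ∀ γ ∈ Γ, γ • κ i ≠ κ j)
    (hκ_std : κ 0 = OnePoint.infty)
    (hΓ_std : cuspStabilizer Γ (κ 0) = gammaInfty)
    (σ : Fin q → PSL(2, ℝ)) (hσ_std : σ 0 = 1)
    (hσ : ∀ j, IsScalingMatrix Γ (κ j) (σ j))
    (h : AddCircle (1 : ℝ) → Real.Angle → ℂ) (hh : SmoothOnTorus h)
    (j : Fin q) (L : ℝ) :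
    ∃ C : ℝ, ∀ (B₀ B₁ T y δ η η' α β : ℝ) (hy : 0 < y),
      1 < B₀ → B₀ < B₁ → B₁ ≤ T →
      |η| ≤ min ((B₁ - B₀) / 2) (1 / 4) → |η'| ≤ min ((B₁ - B₀) / 2) (1 / 4) →
      y < T - min ((B₁ - B₀) / 2) (1 / 4) →
      0 < δ → δ ≤ 1 / 2 →
      T ^ (-(3 / 4 : ℝ) + δ) < β - α → β - α ≤ L →
      IntervalIntegrable (fun x => testFun Γ (κ j) (σ j) h T η (horoPt y hy x)) volume α β ∧
      IntervalIntegrable (fun x => testFunAvg Γ (κ j) (σ j) h T η' (horoPt y hy x)) volume α β ∧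
      ‖(∫ x in α..β, testFun Γ (κ j) (σ j) h T η (horoPt y hy x)) -
        ∫ x in α..β, testFunAvg Γ (κ j) (σ j) h T η' (horoPt y hy x)‖ ≤ C * T ^ (-δ) := by
  obtain ⟨H, hH0, hH⟩ := hh.exists_bound
  have hcont := ContDiff.continuous hh
  have hM : 0 ≤ ∫ s, |mollifier s| := integral_nonneg fun _ => abs_nonneg _
  set M := (1 + ∫ s, |mollifier s|) * H with hMdef
  have hM0 : 0 ≤ M := by positivity
  -- Each integral is at most `2M(L + 5)/(T/2)`, and there are two of them.
  refine ⟨8 * M * (L + 5), ?_⟩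
  intro B₀ B₁ T y δ η η' α β hy hB₀ hB hBT hη hη' hyT _ hδ hαβ hL
  have hT : 1 < T := by linarith
  have hlen : 0 < β - α := (Real.rpow_pos_of_pos (by linarith) _).trans hαβ
  rw [hκ_std] at hΓ_std
  have hcase : (κ j = OnePoint.infty ∧ σ j = 1) ∨ ∀ γ ∈ Γ, γ • OnePoint.infty ≠ κ j := by
    by_cases hj : (0 : Fin q) = j
    · exact Or.inl (hj ▸ ⟨hκ_std, hσ_std⟩)
    · exact Or.inr (hκ_std ▸ hκ_ineq 0 j hj)
  obtain ⟨i1, b1⟩ := intervalIntegral_testFun_bound hΓ.discrete (hσ j) hΓ_std hcase hcont hH hy hT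
    (hη.trans (min_le_right _ _)) (by linarith) (by linarith : α ≤ β)
  -- The averaged sum is the same construction for a function constant in `x`, with the same sup
  -- bound `H`.
  obtain ⟨i2, b2⟩ := intervalIntegral_testFun_bound hΓ.discrete (hσ j) hΓ_std hcase
    (k := fun _ θ => ∫ t in (0 : ℝ)..1, h (t : AddCircle (1 : ℝ)) θ)
    (continuous_torusAverage hcont) (fun _ θ => norm_torusAverage_le hH θ) hy hT
    (hη'.trans (min_le_right _ _)) (by linarith) (by linarith : α ≤ β)
  refine ⟨i1, i2, (norm_sub_le _ _).trans ((add_le_add b1 b2).trans ?_)⟩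
  have hTδ : T⁻¹ ≤ T ^ (-δ) := by
    rw [← Real.rpow_neg_one]
    exact Real.rpow_le_rpow_of_exponent_le hT.le (by linarith)
  calc 2 * M * (β - α + 5) / (T / 2) + 2 * M * (β - α + 5) / (T / 2)
      = 8 * M * (β - α + 5) * T⁻¹ := by field_simp; ring
    _ ≤ 8 * M * (L + 5) * T ^ (-δ) := by
        have : 0 ≤ L + 5 := by linarith
        gcongr
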